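/- Let $k$ be a field and let $A$ be a finite-dimensional elementary $k$-algebra, that is, a finite-dimensional associative unital $k$-algebra such that $A/J \cong k^n$ as $k$-algebras for some natural number $n$, where $J$ is the Jacobson radical of $A$. Let $S$ be a simple left $A$-module of finite projective dimension, $\operatorname{pd}_A S < \infty$. Then $\operatorname{Ext}^1_A(S,S) = 0$. -/

import Mathlib

universe u v

/-- A `k`-algebra `A` with Jacobson radical `J` is elementary if `A / J` is isomorphic, as a
`k`-algebra, to a finite product `k × ⋯ × k` of copies of `k`. -/
def IsElementaryAlgebra (k : Type u) (A : Type v) [Field k] [Ring A] [Algebra k A] : Prop :=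
  ∃ n : ℕ, Nonempty ((A ⧸ Ring.jacobson A) ≃ₐ[k] (Fin n → k))

/-!
Let `ε` be an exact endomorphism of a finite-dimensional `A`-module `X`, so that `X` is free over
the dual numbers `k[ε]`. If `σ` is a `k`-linear contraction of `ε` and `φ` commutes with `ε`, then
`tr (φ σ)` is the `ε`-coefficient of the trace of `φ` over `k[ε]`; in particular it does not depend
on `σ`, and it is additive along short exact sequences. For the action of a nilpotent `a : A` it
vanishes as soon as `ker ε` has finite projective dimension: if `ker ε` is projective, `σ` can be
taken `A`-linear and then `a σ` is nilpotent; in general one shifts dimension by covering `X` with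
the cone of the identity of a free module.

If `Ext¹(S, S) ≠ 0`, some `A`-linear `f : ann S → S` is nonzero at an element `a` of the radical.
Right multiplication by `a` is an exact endomorphism `ε` of `A ⧸ ker f` with kernel isomorphic to
`S`, and since `S` is one-dimensional, left multiplication by `a` coincides with `ε`. Hence
`0 = tr (a σ) = tr (ε σ) = dim ker ε = 1` in `k`, which is absurd.
-/

/-- `σ` is a contraction of the differential `ε` if it is a homotopy from the identity to zero.
Differential modules here are ungraded, so `ε` and `σ` are elements of one ring, usually
`Module.End A X`, and no signs appear. -/
def IsContraction {R : Type*} [Ring R] (ε σ : R) : Prop :=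
  ε * σ + σ * ε = 1

namespace IsContraction

section Linear

variable {R M M' M'' : Type*} [Ring R] [AddCommGroup M] [Module R M]
  [AddCommGroup M'] [Module R M'] [AddCommGroup M''] [Module R M'']

theorem apply {ε σ : Module.End R M} (h : IsContraction ε σ) (x : M) :
    ε (σ x) + σ (ε x) = x :=
  LinearMap.congr_fun h x

theorem restrictScalars (k : Type*) [Ring k] [Module k M] [LinearMap.CompatibleSMul M M k R]
    {ε σ : Module.End R M} (h : IsContraction ε σ) :
    IsContraction (ε.restrictScalars k : Module.End k M) (σ.restrictScalars k) :=
  LinearMap.ext h.apply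

theorem exists_of_exact {ε : Module.End R M} (hε : Function.Exact ε ε)
    [Module.Projective R (LinearMap.ker ε)] : ∃ σ, IsContraction ε σ := by
  let π : M →ₗ[R] LinearMap.ker ε := ε.codRestrict _ hε.apply_apply_eq_zero
  have hπ : LinearMap.range π = ⊤ := LinearMap.range_eq_top.2 fun x ↦
    ((hε x).1 x.2).imp fun _ ↦ Subtype.ext
  obtain ⟨g, hg⟩ := π.exists_rightInverse_of_surjective hπ
  have hεg (x : LinearMap.ker ε) : ε (g x) = x := congr_arg Subtype.val (LinearMap.congr_fun hg x)
  have hεgπ (x : M) : ε (g (π x)) = ε x := hεg (π x)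
  have hπε (x : M) : π (ε x) = 0 := Subtype.ext (hε.apply_apply_eq_zero x)
  let ρ : M →ₗ[R] LinearMap.ker ε :=
    (1 - g ∘ₗ π).codRestrict _ fun x ↦ by simp [hεgπ]
  have hρ (x : M) : (ρ x : M) = x - g (π x) := rfl
  have hρε (x : M) : ρ (ε x) = π x := Subtype.ext (by rw [hρ, hπε, map_zero, sub_zero]; rfl)
  refine ⟨g ∘ₗ ρ, LinearMap.ext fun x ↦ ?_⟩
  calc ε (g (ρ x)) + g (ρ (ε x)) = x - g (π x) + g (π x) := by rw [hεg, hρ, hρε]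
    _ = x := sub_add_cancel _ _

theorem isProj_ker {ε σ : Module.End R M} (hσ : IsContraction ε σ) (hε : ∀ x, ε (ε x) = 0) :
    LinearMap.IsProj (LinearMap.ker ε) (ε * σ) where
  map_mem x := hε (σ x)
  map_id x hx := by
    have h := hσ.apply x
    rwa [LinearMap.mem_ker.1 hx, map_zero, add_zero] at h

theorem projective_ker [Module.Projective R M] {ε σ : Module.End R M} (hσ : IsContraction ε σ)
    (hε : ∀ x, ε (ε x) = 0) : Module.Projective R (LinearMap.ker ε) :=
  .of_split (LinearMap.ker ε).subtype (hσ.isProj_ker hε).codRestrict <|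
    LinearMap.ext (hσ.isProj_ker hε).codRestrict_apply_cod

theorem exists_section [Module.Projective R M''] {ε : Module.End R M} {ε'' σ'' : Module.End R M''}
    (hε : ∀ x, ε (ε x) = 0) (hε'' : ∀ y, ε'' (ε'' y) = 0) (hσ'' : IsContraction ε'' σ'')
    {q : M →ₗ[R] M''} (hq : Function.Surjective q) (hqε : ∀ x, q (ε x) = ε'' (q x)) :
    ∃ s : M'' →ₗ[R] M, (∀ y, q (s y) = y) ∧ ∀ y, ε (s y) = s (ε'' y) := by
  obtain ⟨s₀, h⟩ := q.exists_rightInverse_of_surjective (LinearMap.range_eq_top.2 hq)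
  have hs₀ (y : M'') : q (s₀ y) = y := LinearMap.congr_fun h y
  -- An arbitrary section `s₀` is turned into a morphism of differential modules by the homotopy.
  refine ⟨ε ∘ₗ s₀ ∘ₗ σ'' + s₀ ∘ₗ σ'' ∘ₗ ε'', fun y ↦ ?_, fun y ↦ ?_⟩
  · simp [hqε, hs₀, hσ''.apply]
  · simp [hε, hε'']

theorem of_splitting {ε : Module.End R M} {ε' σ' : Module.End R M'} {ε'' σ'' : Module.End R M''}
    (hσ' : IsContraction ε' σ') (hσ'' : IsContraction ε'' σ'')
    {i : M' →ₗ[R] M} {r : M →ₗ[R] M'} {q : M →ₗ[R] M''} {s : M'' →ₗ[R] M}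
    (hsplit : ∀ x, i (r x) + s (q x) = x)
    (hiε : ∀ x, i (ε' x) = ε (i x)) (hrε : ∀ x, r (ε x) = ε' (r x))
    (hqε : ∀ x, q (ε x) = ε'' (q x)) (hsε : ∀ y, ε (s y) = s (ε'' y)) :
    IsContraction ε (i ∘ₗ σ' ∘ₗ r + s ∘ₗ σ'' ∘ₗ q) := by
  refine LinearMap.ext fun x ↦ ?_
  calc ε (i (σ' (r x)) + s (σ'' (q x))) + (i (σ' (r (ε x))) + s (σ'' (q (ε x))))
      = i (ε' (σ' (r x)) + σ' (ε' (r x))) + s (ε'' (σ'' (q x)) + σ'' (ε'' (q x))) := by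
        simp only [map_add, hiε, hrε, hqε, hsε]; abel
    _ = x := by rw [hσ'.apply, hσ''.apply, hsplit]

end Linear

section Trace

variable {k M M' M'' : Type*} [CommRing k] [AddCommGroup M] [Module k M]
  [AddCommGroup M'] [Module k M'] [AddCommGroup M''] [Module k M'']

theorem trace_mul_eq {ε σ ρ φ : Module.End k M} (hσ : IsContraction ε σ)
    (hρ : IsContraction ε ρ) (hφ : Commute φ ε) :
    LinearMap.trace k M (φ * σ) = LinearMap.trace k M (φ * ρ) := by
  obtain ⟨τ, rfl⟩ : ∃ τ, ρ = σ + τ := ⟨ρ - σ, by abel⟩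
  have hτ : ε * τ + τ * ε = 0 := by
    have h : ε * (σ + τ) + (σ + τ) * ε = ε * σ + σ * ε := hρ.trans hσ.symm
    linear_combination (norm := noncomm_ring) h
  have hcomm : φ * τ = φ * τ * σ * ε - ε * (φ * τ * σ) := by
    calc φ * τ = φ * τ * (ε * σ + σ * ε) := by rw [hσ, mul_one]
      _ = φ * (ε * τ + τ * ε) * σ + φ * τ * σ * ε - φ * ε * τ * σ := by noncomm_ring
      _ = φ * τ * σ * ε - ε * (φ * τ * σ) := by rw [hτ, hφ.eq]; noncomm_ring
  have hzero : LinearMap.trace k M (φ * τ) = 0 := by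
    rw [hcomm, map_sub, LinearMap.trace_mul_comm, sub_self]
  rw [mul_add, map_add, hzero, add_zero]

theorem trace_mul_eq_add [Module.Free k M] [Module.Finite k M] [Module.Free k M']
    [Module.Finite k M'] [Module.Free k M''] [Module.Finite k M'']
    {ε σ φ : Module.End k M} {ε' σ' φ' : Module.End k M'} {ε'' σ'' φ'' : Module.End k M''}
    (hσ : IsContraction ε σ) (hσ' : IsContraction ε' σ') (hσ'' : IsContraction ε'' σ'')
    (hε : ∀ x, ε (ε x) = 0) (hε'' : ∀ y, ε'' (ε'' y) = 0) (hφ : Commute φ ε)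
    {i : M' →ₗ[k] M} {q : M →ₗ[k] M''} (hi : Function.Injective i) (hiq : Function.Exact i q)
    (hq : Function.Surjective q)
    (hiε : ∀ x, i (ε' x) = ε (i x)) (hqε : ∀ x, q (ε x) = ε'' (q x))
    (hiφ : ∀ x, i (φ' x) = φ (i x)) (hqφ : ∀ x, q (φ x) = φ'' (q x)) :
    LinearMap.trace k M (φ * σ) =
      LinearMap.trace k M' (φ' * σ') + LinearMap.trace k M'' (φ'' * σ'') := by
  obtain ⟨s, hqs, hsε⟩ := hσ''.exists_section hε hε'' hq hqε
  let r : M →ₗ[k] M' := (LinearMap.id - s ∘ₗ q).codRestrictOfInjective i hi fun x ↦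
    (hiq _).1 (by simp [hqs])
  have hir (x : M) : i (r x) = x - s (q x) :=
    LinearMap.codRestrictOfInjective_comp_apply ..
  have hri (x : M') : r (i x) = x := hi (by simp [hir, hiq.apply_apply_eq_zero])
  have hrε (x : M) : r (ε x) = ε' (r x) := hi (by simp [hir, hiε, hqε, hsε])
  let ρ : Module.End k M := i ∘ₗ σ' ∘ₗ r + s ∘ₗ σ'' ∘ₗ q
  have hρ : IsContraction ε ρ := hσ'.of_splitting hσ'' (by simp [hir]) hiε hrε hqε hsε
  have htrace' : LinearMap.trace k M (φ ∘ₗ i ∘ₗ σ' ∘ₗ r) = LinearMap.trace k M' (φ' * σ') := by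
    calc LinearMap.trace k M (φ ∘ₗ i ∘ₗ σ' ∘ₗ r)
        = LinearMap.trace k M (i ∘ₗ (φ' ∘ₗ σ' ∘ₗ r)) := by
          congr 1; ext x; simp [hiφ]
      _ = LinearMap.trace k M' ((φ' ∘ₗ σ' ∘ₗ r) ∘ₗ i) := LinearMap.trace_comp_comm' _ _
      _ = LinearMap.trace k M' (φ' * σ') := by congr 1; ext x; simp [hri]
  have htrace'' : LinearMap.trace k M (φ ∘ₗ s ∘ₗ σ'' ∘ₗ q) =
      LinearMap.trace k M'' (φ'' * σ'') := by
    calc LinearMap.trace k M ((φ ∘ₗ s ∘ₗ σ'') ∘ₗ q)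
        = LinearMap.trace k M'' (q ∘ₗ φ ∘ₗ s ∘ₗ σ'') := LinearMap.trace_comp_comm' _ _
      _ = LinearMap.trace k M'' (φ'' * σ'') := by congr 1; ext y; simp [hqφ, hqs]
  rw [hσ.trace_mul_eq hρ hφ, ← htrace', ← htrace'', ← map_add]
  congr 1
  ext x
  simp [ρ]

end Trace

theorem trace_self_mul {k V : Type*} [Field k] [AddCommGroup V] [Module k V]
    [FiniteDimensional k V] {ε σ : Module.End k V} (hσ : IsContraction ε σ)
    (hε : ∀ x, ε (ε x) = 0) :
    LinearMap.trace k V (ε * σ) = Module.finrank k (LinearMap.ker ε) :=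
  (hσ.isProj_ker hε).trace

end IsContraction

section ExactDifferential

variable {A : Type*} [Ring A]

/-- The differential `(x, y) ↦ (0, x)` on `P × P`, that is, the differential of the cone of the
identity of `P` with the grading forgotten. -/
def coneDifferential (A P : Type*) [Ring A] [AddCommGroup P] [Module A P] :
    Module.End A (P × P) :=
  LinearMap.inr A P P ∘ₗ LinearMap.fst A P P

theorem coneDifferential_apply {P : Type*} [AddCommGroup P] [Module A P] (x : P × P) :
    coneDifferential A P x = (0, x.1) :=
  rfl

theorem coneDifferential_isContraction (A P : Type*) [Ring A] [AddCommGroup P] [Module A P] :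
    IsContraction (coneDifferential A P) (LinearMap.inl A P P ∘ₗ LinearMap.snd A P P) :=
  LinearMap.ext fun x ↦ by simp [coneDifferential]

theorem coneDifferential_exact (A P : Type*) [Ring A] [AddCommGroup P] [Module A P] :
    Function.Exact (coneDifferential A P) (coneDifferential A P) := by
  rintro ⟨x, y⟩
  simp only [coneDifferential_apply, Set.mem_range, Prod.mk_eq_zero, Prod.mk.injEq, true_and]
  exact ⟨fun hx ↦ ⟨(y, 0), hx.symm, rfl⟩, fun ⟨_, hx, _⟩ ↦ hx.symm⟩

variable {X Y : Type*} [AddCommGroup X] [Module A X] [AddCommGroup Y] [Module A Y]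
  {ε : Module.End A X} {δ : Module.End A Y} {q : Y →ₗ[A] X}

/-- The differential induced on the kernel of a morphism `q` of differential modules. -/
def kerDifferential (hqδ : ∀ y, q (δ y) = ε (q y)) : Module.End A (LinearMap.ker q) :=
  δ.restrict fun y hy ↦ by rw [LinearMap.mem_ker, hqδ, LinearMap.mem_ker.1 hy, map_zero]

theorem kerDifferential_exact (hδ : Function.Exact δ δ) (hε : Function.Exact ε ε)
    (hq : Function.Surjective q) (hqδ : ∀ y, q (δ y) = ε (q y)) :
    Function.Exact (kerDifferential hqδ) (kerDifferential hqδ) := by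
  rintro ⟨y, hy⟩
  constructor
  · intro h
    obtain ⟨z, rfl⟩ := (hδ y).1 (congr_arg Subtype.val h)
    obtain ⟨w, hw⟩ := (hε (q z)).1 (by rw [← hqδ]; exact hy)
    obtain ⟨u, rfl⟩ := hq w
    refine ⟨⟨z - δ u, ?_⟩, Subtype.ext ?_⟩
    · rw [LinearMap.mem_ker, map_sub, hqδ, hw, sub_self]
    · simp [kerDifferential, hδ.apply_apply_eq_zero]
  · rintro ⟨z, hz⟩
    rw [← hz]
    exact Subtype.ext (hδ.apply_apply_eq_zero (z : Y))

end ExactDifferential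

open CategoryTheory in
theorem hasProjectiveDimensionLT_ker_kerDifferential {A : Type u} {X Y : Type v} [Ring A]
    [Small.{v} A] [AddCommGroup X] [Module A X] [AddCommGroup Y] [Module A Y]
    {ε : Module.End A X} {δ : Module.End A Y} {q : Y →ₗ[A] X}
    [Module.Projective A (LinearMap.ker δ)] (hδ : Function.Exact δ δ) (hε : Function.Exact ε ε)
    (hq : Function.Surjective q) (hqδ : ∀ y, q (δ y) = ε (q y)) {n : ℕ}
    (hpd : HasProjectiveDimensionLT (ModuleCat.of A (LinearMap.ker ε)) (n + 2)) :
    HasProjectiveDimensionLT (ModuleCat.of A (LinearMap.ker (kerDifferential hqδ))) (n + 1) := by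
  let i : LinearMap.ker (kerDifferential hqδ) →ₗ[A] LinearMap.ker δ :=
    (LinearMap.ker q).subtype.restrict fun x hx ↦ congr_arg Subtype.val hx
  let p : LinearMap.ker δ →ₗ[A] LinearMap.ker ε :=
    q.restrict fun y hy ↦ by rw [LinearMap.mem_ker, ← hqδ, LinearMap.mem_ker.1 hy, map_zero]
  have hip : p ∘ₗ i = 0 := LinearMap.ext fun x ↦ Subtype.ext x.1.2
  have hexact : (ModuleCat.shortComplexOfCompEqZero i p hip).ShortExact := by
    refine ModuleCat.shortComplex_shortExact _ (fun y ↦ ⟨fun hy ↦ ?_, ?_⟩) (fun x y hxy ↦ ?_)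
      fun x ↦ ?_
    · exact ⟨⟨⟨y, congr_arg Subtype.val hy⟩, Subtype.ext y.2⟩, rfl⟩
    · rintro ⟨x, rfl⟩
      exact LinearMap.congr_fun hip x
    · exact Subtype.ext (Subtype.ext (congr_arg (fun z : LinearMap.ker δ ↦ (z : Y)) hxy))
    · obtain ⟨w, hw⟩ := (hε x).1 x.2
      obtain ⟨u, rfl⟩ := hq w
      exact ⟨⟨δ u, hδ.apply_apply_eq_zero u⟩, Subtype.ext ((hqδ u).trans hw)⟩
  have : Projective (ModuleCat.of A (LinearMap.ker δ)) :=
    (IsProjective.iff_projective _).1 inferInstance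
  exact (hexact.hasProjectiveDimensionLT_X₃_iff n this).1 hpd

section TraceVanishing

variable {k : Type u} {A : Type v} [Field k] [Ring A] [Algebra k A]

theorem commute_lsmul_restrictScalars {X : Type*} [AddCommGroup X] [Module k X] [Module A X]
    [IsScalarTower k A X] (a : A) (φ : Module.End A X) :
    Commute (Algebra.lsmul k k X a : Module.End k X) (φ.restrictScalars k) :=
  LinearMap.ext fun x ↦ (φ.map_smul a x).symm

theorem trace_lsmul_mul_restrictScalars_eq_zero {X : Type*} [AddCommGroup X] [Module k X]
    [Module A X] [IsScalarTower k A X] {a : A} (ha : IsNilpotent a) (τ : Module.End A X) :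
    LinearMap.trace k X (Algebra.lsmul k k X a * τ.restrictScalars k) = 0 :=
  (LinearMap.isNilpotent_trace_of_isNilpotent
    ((commute_lsmul_restrictScalars a τ).isNilpotent_mul_right (ha.map _))).eq_zero

theorem exists_trace_lsmul_mul_eq_neg {X Y : Type*} [AddCommGroup X] [Module k X] [Module A X]
    [IsScalarTower k A X] [FiniteDimensional k X] [AddCommGroup Y] [Module k Y] [Module A Y]
    [IsScalarTower k A Y] [FiniteDimensional k Y] {a : A} (ha : IsNilpotent a)
    {ε : Module.End A X} {δ τ : Module.End A Y} {q : Y →ₗ[A] X} (hδ : Function.Exact δ δ)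
    (hε : Function.Exact ε ε) (hq : Function.Surjective q) (hqδ : ∀ y, q (δ y) = ε (q y))
    (hτ : IsContraction δ τ) {σ : Module.End k X}
    (hσ : IsContraction (ε.restrictScalars k : Module.End k X) σ) :
    ∃ ρ, IsContraction ((kerDifferential hqδ).restrictScalars k : Module.End k (LinearMap.ker q)) ρ
      ∧ LinearMap.trace k X (Algebra.lsmul k k X a * σ) =
        -LinearMap.trace k _ (Algebra.lsmul k k (LinearMap.ker q) a * ρ) := by
  have : FiniteDimensional k (LinearMap.ker q) :=
    .of_injective ((LinearMap.ker q).subtype.restrictScalars k) Subtype.val_injective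
  obtain ⟨ρ, hρ⟩ := IsContraction.exists_of_exact
    (ε := ((kerDifferential hqδ).restrictScalars k : Module.End k (LinearMap.ker q)))
    (kerDifferential_exact hδ hε hq hqδ)
  have hadd := (hτ.restrictScalars k).trace_mul_eq_add hρ hσ hδ.apply_apply_eq_zero
    hε.apply_apply_eq_zero (commute_lsmul_restrictScalars a δ)
    (i := (LinearMap.ker q).subtype.restrictScalars k) (q := q.restrictScalars k)
    Subtype.val_injective (LinearMap.exact_subtype_ker_map q) hq (fun _ ↦ rfl) hqδ
    (φ' := Algebra.lsmul k k _ a) (φ'' := Algebra.lsmul k k X a) (fun _ ↦ rfl) (q.map_smul a)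
  rw [trace_lsmul_mul_restrictScalars_eq_zero ha] at hadd
  exact ⟨ρ, hρ, eq_neg_of_add_eq_zero_right hadd.symm⟩

open CategoryTheory in
theorem trace_lsmul_mul_eq_zero_of_hasProjectiveDimensionLT [FiniteDimensional k A] {a : A}
    (ha : IsNilpotent a) (n : ℕ) {X : Type v} [AddCommGroup X] [Module k X] [Module A X]
    [IsScalarTower k A X] [FiniteDimensional k X] {ε : Module.End A X} (hε : Function.Exact ε ε)
    (hpd : HasProjectiveDimensionLT (ModuleCat.of A (LinearMap.ker ε)) (n + 1))
    {σ : Module.End k X} (hσ : IsContraction (ε.restrictScalars k : Module.End k X) σ) :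
    LinearMap.trace k X (Algebra.lsmul k k X a * σ) = 0 := by
  induction n generalizing X with
  | zero =>
    have : Module.Projective A (LinearMap.ker ε) :=
      (IsProjective.iff_projective _).2 ((projective_iff_hasProjectiveDimensionLT_one).2 hpd)
    obtain ⟨τ, hτ⟩ := IsContraction.exists_of_exact hε
    rw [hσ.trace_mul_eq (hτ.restrictScalars k) (commute_lsmul_restrictScalars a ε)]
    exact trace_lsmul_mul_restrictScalars_eq_zero ha τ
  | succ n ih =>
    have : Module.Finite A X := .of_restrictScalars_finite k A X
    obtain ⟨m, f, hf⟩ := Module.Finite.exists_fin' A X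
    have hδ := coneDifferential_exact A (Fin m → A)
    have hτ := coneDifferential_isContraction A (Fin m → A)
    have : Module.Projective A (LinearMap.ker (coneDifferential A (Fin m → A))) :=
      hτ.projective_ker hδ.apply_apply_eq_zero
    let q : (Fin m → A) × (Fin m → A) →ₗ[A] X := f.coprod (ε ∘ₗ f)
    have hq : Function.Surjective q := fun x ↦
      (hf x).elim fun p hp ↦ ⟨(p, 0), by simp [q, hp]⟩
    have hqδ (y) : q (coneDifferential A _ y) = ε (q y) := by
      simp [q, coneDifferential_apply, hε.apply_apply_eq_zero]
    have : FiniteDimensional k (LinearMap.ker q) :=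
      .of_injective ((LinearMap.ker q).subtype.restrictScalars k) Subtype.val_injective
    obtain ⟨ρ, hρ, htrace⟩ := exists_trace_lsmul_mul_eq_neg ha hδ hε hq hqδ hτ hσ
    rw [htrace, ih (kerDifferential_exact hδ hε hq hqδ)
      (hasProjectiveDimensionLT_ker_kerDifferential hδ hε hq hqδ hpd) hρ, neg_zero]

end TraceVanishing

section SelfExtension

open CategoryTheory Abelian in
theorem subsingleton_ext_one_of_forall_exists_extension {A : Type u} [Ring A] [Small.{v} A]
    {P M N : Type v} [AddCommGroup P] [Module A P] [Module.Projective A P] [AddCommGroup M]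
    [Module A M] [AddCommGroup N] [Module A N] {q : P →ₗ[A] M} (hq : Function.Surjective q)
    {K : Submodule A P} (hK : LinearMap.ker q = K)
    (hext : ∀ f : K →ₗ[A] N, ∃ g : P →ₗ[A] N, g ∘ₗ K.subtype = f) :
    Subsingleton (Ext (ModuleCat.of A M) (ModuleCat.of A N) 1) := by
  subst hK
  have hE := LinearMap.shortExact_shortComplexKer hq
  have : Projective q.shortComplexKer.X₂ :=
    inferInstanceAs (Projective (ModuleCat.of A P))
  refine subsingleton_of_forall_eq 0 fun x ↦ ?_
  obtain ⟨y, rfl⟩ := precomp_extClass_surjective_of_projective_X₂ (ModuleCat.of A N) hE 0 x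
  obtain ⟨f, rfl⟩ := (Ext.mk₀_bijective _ _).2 y
  obtain ⟨g, hg⟩ := hext f.hom
  have hf : f = q.shortComplexKer.f ≫ ModuleCat.ofHom g := ModuleCat.hom_ext hg.symm
  change hE.extClass.comp (Ext.mk₀ f) (add_comm 1 0) = 0
  rw [hf, ← Ext.mk₀_comp_mk₀, hE.extClass_comp_assoc]

theorem exists_extension_of_forall_mem_jacobson {A : Type*} [Ring A] [IsArtinianRing A]
    {S : Type*} [AddCommGroup S] [Module A S] {m : Submodule A A} (f : m →ₗ[A] S)
    (hf : ∀ x : m, (x : A) ∈ Ring.jacobson A → f x = 0) :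
    ∃ g : A →ₗ[A] S, g ∘ₗ m.subtype = f := by
  let J := Module.jacobson A A
  have : IsSemisimpleModule A (A ⧸ J) :=
    (IsArtinian.isSemisimpleModule_iff_jacobson A _).2 (Module.jacobson_quotient_jacobson A A)
  let K : Submodule A m := J.comap m.subtype
  have hinj : Function.Injective (K.mapQ J m.subtype le_rfl) := by
    rw [← LinearMap.ker_eq_bot, Submodule.ker_mapQ, Submodule.mkQ_map_self]
  obtain ⟨g, hg⟩ := IsSemisimpleModule.extension_property _ hinj (K.liftQ f hf)
  exact ⟨g ∘ₗ J.mkQ, LinearMap.ext fun x ↦ LinearMap.congr_fun hg (Submodule.Quotient.mk x)⟩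

variable {A S : Type*} [Ring A] [AddCommGroup S] [Module A S]

/-- The kernel of `f : Module.annihilator A S → S`, regarded as a left ideal of `A`. The quotient
`A ⧸ kerIdeal f` is the middle term of the self-extension of `S` classified by `f`. -/
def kerIdeal (f : Module.annihilator A S →ₗ[A] S) : Submodule A A :=
  (LinearMap.ker f).map (Submodule.subtype _)

theorem coe_mem_kerIdeal (f : Module.annihilator A S →ₗ[A] S) (y : Module.annihilator A S) :
    (y : A) ∈ kerIdeal f ↔ f y = 0 := by
  simp [kerIdeal]

theorem kerIdeal_le_annihilator (f : Module.annihilator A S →ₗ[A] S) :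
    kerIdeal f ≤ Module.annihilator A S :=
  Submodule.map_subtype_le _ _

theorem mul_mem_kerIdeal_iff (f : Module.annihilator A S →ₗ[A] S) (a : Module.annihilator A S)
    (x : A) : x * a ∈ kerIdeal f ↔ x • f a = 0 := by
  rw [← map_smul]
  exact coe_mem_kerIdeal f (x • a)

/-- Right multiplication by `a` on `A ⧸ kerIdeal f`. When `f a` generates `S` it is the composite
`A ⧸ kerIdeal f → S → A ⧸ kerIdeal f` of the two maps of the self-extension. -/
def mulRightEnd (f : Module.annihilator A S →ₗ[A] S) (a : Module.annihilator A S) :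
    Module.End A (A ⧸ kerIdeal f) :=
  (kerIdeal f).mapQ _ (LinearMap.toSpanSingleton A A (a : A)) fun x hx ↦
    (mul_mem_kerIdeal_iff f a x).2 (Module.mem_annihilator.1 (kerIdeal_le_annihilator f hx) _)

theorem mulRightEnd_mk (f : Module.annihilator A S →ₗ[A] S) (a : Module.annihilator A S) (x : A) :
    mulRightEnd f a (Submodule.Quotient.mk x) = Submodule.Quotient.mk (x * a) :=
  rfl

theorem mulRightEnd_mk_eq_zero_iff (f : Module.annihilator A S →ₗ[A] S)
    (a : Module.annihilator A S) (x : A) :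
    mulRightEnd f a (Submodule.Quotient.mk x) = 0 ↔ x • f a = 0 := by
  rw [mulRightEnd_mk, Submodule.Quotient.mk_eq_zero, mul_mem_kerIdeal_iff]

end SelfExtension

section OneDimensional

variable {k A S : Type*} [Field k] [Ring A] [Algebra k A] [AddCommGroup S] [Module k S]
  [Module A S] [IsScalarTower k A S]

theorem exists_forall_smul_eq_of_finrank_eq_one (hS : Module.finrank k S = 1) (x : A) :
    ∃ c : k, ∀ t : S, x • t = c • t := by
  obtain ⟨c, hc, -⟩ := LinearMap.existsUnique_eq_smul_id_of_finrank_eq_one hS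
    (Algebra.lsmul k k S x)
  exact ⟨c, LinearMap.congr_fun hc⟩

theorem mem_annihilator_of_smul_eq_zero (hS : Module.finrank k S = 1) {s : S} (hs : s ≠ 0) {x : A}
    (hx : x • s = 0) : x ∈ Module.annihilator A S := by
  obtain ⟨c, hc⟩ := exists_forall_smul_eq_of_finrank_eq_one hS x
  have : c = 0 := (smul_eq_zero.1 ((hc s).symm.trans hx)).resolve_right hs
  exact Module.mem_annihilator.2 fun t ↦ by rw [hc, this, zero_smul]

variable (A) in
theorem toSpanSingleton_surjective_of_finrank_eq_one (hS : Module.finrank k S = 1) {s : S}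
    (hs : s ≠ 0) : Function.Surjective (LinearMap.toSpanSingleton A S s) := fun t ↦ by
  obtain ⟨c, hc⟩ := exists_smul_eq_of_finrank_eq_one hS hs t
  exact ⟨algebraMap k A c, by simpa using hc⟩

theorem mulRightEnd_exact (hS : Module.finrank k S = 1) {f : Module.annihilator A S →ₗ[A] S}
    {a : Module.annihilator A S} (hfa : f a ≠ 0) :
    Function.Exact (mulRightEnd f a) (mulRightEnd f a) := by
  intro e
  obtain ⟨x, rfl⟩ := Submodule.Quotient.mk_surjective _ e
  rw [mulRightEnd_mk_eq_zero_iff]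
  constructor
  · intro hx
    have hxm := mem_annihilator_of_smul_eq_zero hS hfa hx
    obtain ⟨y, hy : y • f a = f ⟨x, hxm⟩⟩ :=
      toSpanSingleton_surjective_of_finrank_eq_one A hS hfa (f ⟨x, hxm⟩)
    refine ⟨Submodule.Quotient.mk y, (Submodule.Quotient.eq _).2 ?_⟩
    exact (coe_mem_kerIdeal f (y • a - ⟨x, hxm⟩)).2 (by rw [map_sub, map_smul, hy, sub_self])
  · rintro ⟨e, he⟩
    obtain ⟨y, rfl⟩ := Submodule.Quotient.mk_surjective _ e
    rw [← mulRightEnd_mk_eq_zero_iff, ← he, mulRightEnd_mk, mulRightEnd_mk_eq_zero_iff]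
    exact Module.mem_annihilator.1 (Ideal.mul_mem_left _ y a.2) _

theorem smul_eq_mulRightEnd (hS : Module.finrank k S = 1) (f : Module.annihilator A S →ₗ[A] S)
    (a : Module.annihilator A S) (e : A ⧸ kerIdeal f) : (a : A) • e = mulRightEnd f a e := by
  obtain ⟨x, rfl⟩ := Submodule.Quotient.mk_surjective _ e
  obtain ⟨c, hc⟩ := exists_forall_smul_eq_of_finrank_eq_one hS x
  let y : Module.annihilator A S := ⟨x - algebraMap k A c, Module.mem_annihilator.2 fun t ↦ by
    rw [sub_smul, hc, algebraMap_smul, sub_self]⟩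
  have hy : f ((a : A) • y - (y : A) • a) = 0 := by
    rw [map_sub, map_smul, map_smul, Module.mem_annihilator.1 a.2, Module.mem_annihilator.1 y.2,
      sub_zero]
  have hcomm : a * x - x * a = ((a : A) • y - (y : A) • a : Module.annihilator A S) := by
    simp [y, mul_sub, sub_mul, Algebra.commutes c (a : A)]
  refine (Submodule.Quotient.eq _).2 ?_
  change (a : A) * x - x * a ∈ kerIdeal f
  rw [hcomm, coe_mem_kerIdeal, hy]

theorem nonempty_ker_mulRightEnd_equiv (hS : Module.finrank k S = 1)
    {f : Module.annihilator A S →ₗ[A] S} {a : Module.annihilator A S} (hfa : f a ≠ 0) :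
    Nonempty (LinearMap.ker (mulRightEnd f a) ≃ₗ[A] S) := by
  let φ : A →ₗ[A] A ⧸ kerIdeal f := mulRightEnd f a ∘ₗ (kerIdeal f).mkQ
  have hker : LinearMap.ker (LinearMap.toSpanSingleton A S (f a)) = LinearMap.ker φ :=
    Submodule.ext fun x ↦ (mulRightEnd_mk_eq_zero_iff f a x).symm
  have hrange : LinearMap.range φ = LinearMap.ker (mulRightEnd f a) := by
    rw [LinearMap.range_comp, Submodule.range_mkQ, Submodule.map_top,
      (LinearMap.exact_iff.1 (mulRightEnd_exact hS hfa))]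
  exact ⟨(LinearEquiv.ofEq _ _ hrange).symm ≪≫ₗ φ.quotKerEquivRange.symm ≪≫ₗ
    Submodule.quotEquivOfEq _ _ hker.symm ≪≫ₗ LinearMap.quotKerEquivOfSurjective _
      (toSpanSingleton_surjective_of_finrank_eq_one A hS hfa)⟩

open CategoryTheory Abelian in
theorem subsingleton_ext_one_of_forall_mem_jacobson {A S : Type v} [Ring A] [Algebra k A]
    [IsArtinianRing A] [AddCommGroup S] [Module k S] [Module A S]
    [IsScalarTower k A S] (hS : Module.finrank k S = 1)
    (h : ∀ (f : Module.annihilator A S →ₗ[A] S) (a : Module.annihilator A S),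
      (a : A) ∈ Ring.jacobson A → f a = 0) :
    Subsingleton (Ext (ModuleCat.of A S) (ModuleCat.of A S) 1) := by
  have : Nontrivial S := Module.nontrivial_of_finrank_eq_succ hS
  obtain ⟨s, hs⟩ := exists_ne (0 : S)
  have hker : LinearMap.ker (LinearMap.toSpanSingleton A S s) = Module.annihilator A S :=
    Submodule.ext fun _ ↦
      ⟨mem_annihilator_of_smul_eq_zero hS hs, fun hx ↦ Module.mem_annihilator.1 hx s⟩
  exact subsingleton_ext_one_of_forall_exists_extension
    (toSpanSingleton_surjective_of_finrank_eq_one A hS hs) hker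
    fun f ↦ exists_extension_of_forall_mem_jacobson f (h f)

end OneDimensional

theorem isNilpotent_of_mem_jacobson {A : Type*} [Ring A] [IsArtinianRing A] {a : A}
    (ha : a ∈ Ring.jacobson A) : IsNilpotent a := by
  obtain ⟨n, hn⟩ := IsSemiprimaryRing.isNilpotent (R := A)
  exact ⟨n, by simpa [hn] using Ideal.pow_mem_pow ha n⟩

namespace IsElementaryAlgebra

variable {k : Type u} {A : Type v} [Field k] [Ring A] [Algebra k A]

theorem exists_algHom_surjective (hA : IsElementaryAlgebra k A) :
    ∃ (n : ℕ) (π : A →ₐ[k] (Fin n → k)),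
      Function.Surjective π ∧ ∀ x, π x = 0 → x ∈ Ring.jacobson A := by
  obtain ⟨n, ⟨Φ⟩⟩ := hA
  refine ⟨n, Φ.toAlgHom.comp (Ideal.Quotient.mkₐ k (Ring.jacobson A)),
    Φ.surjective.comp Ideal.Quotient.mk_surjective, fun x hx ↦ ?_⟩
  exact Ideal.Quotient.eq_zero_iff_mem.1 (Φ.injective (hx.trans (map_zero Φ).symm))

theorem finrank_eq_one (hA : IsElementaryAlgebra k A) (S : Type*) [AddCommGroup S] [Module k S]
    [Module A S] [IsScalarTower k A S] [IsSimpleModule A S] : Module.finrank k S = 1 := by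
  obtain ⟨n, π, hπ, hJ⟩ := hA.exists_algHom_surjective
  have hsmul {x y : A} (hxy : π x = π y) (s : S) : x • s = y • s := by
    have hmem : x - y ∈ Ring.jacobson A := hJ _ (by rw [map_sub, hxy, sub_self])
    rw [← sub_eq_zero, ← sub_smul]
    exact Module.mem_annihilator.1 (IsSemisimpleModule.jacobson_le_annihilator A S hmem) s
  choose e he using fun i : Fin n ↦ hπ (Pi.single i 1)
  have : Nontrivial S := IsSimpleModule.nontrivial A S
  obtain ⟨s, hs⟩ := exists_ne (0 : S)
  have hsum : ∑ i, e i • s = s := by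
    rw [← Finset.sum_smul, hsmul (y := 1), one_smul]
    simp only [map_sum, he, map_one]
    exact Finset.univ_sum_single 1
  obtain ⟨i, -, hi⟩ := Finset.exists_ne_zero_of_sum_ne_zero (hsum.trans_ne hs)
  refine _root_.finrank_eq_one (e i • s) hi fun t ↦ ?_
  obtain ⟨x, rfl⟩ := IsSimpleModule.toSpanSingleton_surjective A hi t
  refine ⟨π x i, ?_⟩
  rw [LinearMap.toSpanSingleton_apply, ← algebraMap_smul A (π x i), smul_smul, smul_smul]
  refine hsmul ?_ s
  rw [map_mul, map_mul, he, AlgHom.commutes]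
  ext j
  rcases eq_or_ne j i with rfl | hj <;> simp [*]

end IsElementaryAlgebra

theorem theorem2_general (k : Type u) [Field k] (A : Type v) [Ring A] [Algebra k A]
    [FiniteDimensional k A] (S : Type v) [AddCommGroup S] [Module k S] [Module A S]
    [IsScalarTower k A S] (hS : Module.finrank k S = 1)
    (hpd : CategoryTheory.projectiveDimension (ModuleCat.of A S) < ⊤) :
    Subsingleton (CategoryTheory.Abelian.Ext (ModuleCat.of A S) (ModuleCat.of A S) 1) := by
  have : IsArtinianRing A := .of_finite k A
  refine subsingleton_ext_one_of_forall_mem_jacobson hS fun f a ha ↦ ?_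
  by_contra hfa
  have hexact := mulRightEnd_exact hS hfa
  obtain ⟨e⟩ := nonempty_ker_mulRightEnd_equiv hS hfa
  obtain ⟨d, _⟩ := (CategoryTheory.projectiveDimension_ne_top_iff _).1 hpd.ne
  have hker : CategoryTheory.HasProjectiveDimensionLT
      (ModuleCat.of A (LinearMap.ker (mulRightEnd f a))) (d + 1) :=
    CategoryTheory.hasProjectiveDimensionLT_of_iso e.symm.toModuleIso (d + 1)
  obtain ⟨σ, hσ⟩ := IsContraction.exists_of_exact
    (ε := ((mulRightEnd f a).restrictScalars k : Module.End k (A ⧸ kerIdeal f))) hexact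
  have hzero := trace_lsmul_mul_eq_zero_of_hasProjectiveDimensionLT
    (isNilpotent_of_mem_jacobson ha) d hexact hker hσ
  have hlsmul : Algebra.lsmul k k (A ⧸ kerIdeal f) (a : A) = (mulRightEnd f a).restrictScalars k :=
    LinearMap.ext (smul_eq_mulRightEnd hS f a)
  have hrank : Module.finrank k (LinearMap.ker ((mulRightEnd f a).restrictScalars k)) = 1 :=
    (e.restrictScalars k).finrank_eq.trans hS
  rw [hlsmul, hσ.trace_self_mul hexact.apply_apply_eq_zero, hrank, Nat.cast_one] at hzero
  exact one_ne_zero hzero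

theorem theorem2 (k : Type u) [Field k] (A : Type v) [Ring A] [Algebra k A]
    [FiniteDimensional k A] (hA : IsElementaryAlgebra k A)
    (S : Type v) [AddCommGroup S] [Module A S] [IsSimpleModule A S]
    (hS : CategoryTheory.projectiveDimension (ModuleCat.of A S) < ⊤) :
    Subsingleton (CategoryTheory.Abelian.Ext (ModuleCat.of A S) (ModuleCat.of A S) 1) := by
  let _ : Module k S := Module.compHom S (algebraMap k A)
  have : IsScalarTower k A S := .of_compHom k A S
  exact theorem2_general k A S (hA.finrank_eq_one S) hS
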